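/- Theorem (Asymptotic normality of the Fenchel–Young estimator). Let $\Delta\subset\mathbb{R}^K$ be the probability simplex and let $\Lambda:\Delta\to(-\infty,\infty]$ be a convex, lower semicontinuous function that is finite, strictly convex and continuously differentiable on the relative interior of $\Delta$ and such that, for every $V\in\mathbb{R}^K$, the choice probability vector $p(V)=\arg\max_{p\in\Delta}\{p^\top V-\Lambda(p)\}$ exists and is unique. Let $\Omega(V)=\sup_{p\in\Delta}\{p^\top V-\Lambda(p)\}$ be the surplus function, let $V(x;\beta)=(\beta^\top x_1,\dots,\beta^\top x_K)$ for $x=(x_1,\dots,x_K)\in(\mathbb{R}^d)^K$ and $\beta\in\mathbb{R}^d$, and let $\ell(\beta;x,y)=\Omega(V(x;\beta))-y^\top V(x;\beta)$ be the Fenchel–Young loss. Let $(X_n,Y_n)_{n\ge 1}$ be i.i.d. with values in $(\mathbb{R}^d)^K\times\{e_1,\dots,e_K\}$ and with the law of $(X,Y)$, and suppose that the model is well specified: $\mathbb{E}[Y\mid X]=p(V(X;\beta^\star))$ almost surely, where $\beta^\star$ is an interior point of the parameter set $B\subseteq\mathbb{R}^d$ (for instance $B=\mathbb{R}^d$, or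 $B$ compact). For each $N$, let $\hat\beta_N$ be a random vector that almost surely minimizes $\beta\mapsto\frac1N\sum_{n=1}^N\ell(\beta;X_n,Y_n)$ over $B$ whenever a minimizer exists. Assume: 1. (Regularity) Almost surely, $\Omega$ is twice continuously differentiable in a neighborhood of $V(X;\beta^\star)$. Moreover there are a neighborhood $U$ of $\beta^\star$ and a function $M$ with $\mathbb{E}|M(X,Y)|<\infty$ such that, almost surely, $\|\nabla_\beta\ell(\beta;X,Y)-\nabla_\beta\ell(\beta^\star;X,Y)\|\le M(X,Y)\,\|\beta-\beta^\star\|$ for all $\beta\in U$. (Given condition 3, the second part holds automatically if $\nabla\Omega$ is Lipschitz continuous.) 2. (Non-singularity) The expected Hessian $H=\mathbb{E}[\nabla^2_\beta\ell(\beta^\star;X,Y)]$ is positive definite. 3. (Finite moments) $\mathbb{E}\|X\|^2<\infty$. Then, as $N\to\infty$, $$\sqrt N(\hat\beta_N-\beta^\star)\xrightarrow{d}\mathcal N\left(0,\;H^{-1}JH^{-1}\right),\qquad J=\mathbb{E}\left[\nabla_\beta\ell(\beta^\star;X,Y)\,\nabla_\beta\ell(\beta^\star;X,Y)^\top\right].$$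 -/

import Mathlib

open MeasureTheory ProbabilityTheory Filter Topology Matrix

noncomputable section

namespace FenchelYoung

/-- `p` is a choice probability vector of the perturbed utility model with perturbation `Λ` at the
utilities `V`: it maximizes `q ↦ q · V - Λ q` over the probability simplex. The perturbation takes
values in the extended reals (the value `⊤` is allowed on the boundary of the simplex); only its
values on the simplex matter. -/
def IsChoiceProb {K : ℕ} (Λ : (Fin K → ℝ) → EReal) (V p : Fin K → ℝ) : Prop :=
  p ∈ stdSimplex ℝ (Fin K) ∧
    ∀ q ∈ stdSimplex ℝ (Fin K), ((q ⬝ᵥ V : ℝ) : EReal) - Λ q ≤ ((p ⬝ᵥ V : ℝ) : EReal) - Λ p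

/-- Admissible perturbation functions of a perturbed utility model: closed convex functions from
the simplex to `(-∞, ∞]`, finite, strictly convex and continuously differentiable on the relative
interior, for which the choice probability vector is well defined at all utilities. -/
structure IsPerturbation {K : ℕ} (Λ : (Fin K → ℝ) → EReal) : Prop where
  ne_bot : ∀ p ∈ stdSimplex ℝ (Fin K), Λ p ≠ ⊥
  ne_top : ∀ p ∈ intrinsicInterior ℝ (stdSimplex ℝ (Fin K)), Λ p ≠ ⊤
  lowerSemicontinuousOn : LowerSemicontinuousOn Λ (stdSimplex ℝ (Fin K))
  convex : ∀ p ∈ stdSimplex ℝ (Fin K), ∀ q ∈ stdSimplex ℝ (Fin K), ∀ a b : ℝ,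
    0 ≤ a → 0 ≤ b → a + b = 1 → Λ (a • p + b • q) ≤ (a : EReal) * Λ p + (b : EReal) * Λ q
  strictConvexOn : StrictConvexOn ℝ (intrinsicInterior ℝ (stdSimplex ℝ (Fin K)))
    (fun p => (Λ p).toReal)
  contDiffOn : ContDiffOn ℝ 1 (fun p => (Λ p).toReal)
    (intrinsicInterior ℝ (stdSimplex ℝ (Fin K)))
  existsUnique_choiceProb : ∀ V : Fin K → ℝ, ∃! p, IsChoiceProb Λ V p

/-- The surplus function `Ω(V) = sup_{p ∈ Δ} (p · V - Λ p)`. For an admissible perturbation the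
supremum is finite. -/
def surplus {K : ℕ} (Λ : (Fin K → ℝ) → EReal) (V : Fin K → ℝ) : ℝ :=
  (⨆ p ∈ stdSimplex ℝ (Fin K), ((p ⬝ᵥ V : ℝ) : EReal) - Λ p).toReal

/-- The systematic utilities `V_i = βᵀ x_i`. -/
def utility {K d : ℕ} (x : Fin K → EuclideanSpace ℝ (Fin d)) (β : EuclideanSpace ℝ (Fin d)) :
    Fin K → ℝ :=
  fun i => inner ℝ β (x i)

/-- The Fenchel-Young loss `Ω(V(x; β)) - yᵀ V(x; β)`. -/
def fyLoss {K d : ℕ} (Λ : (Fin K → ℝ) → EReal) (x : Fin K → EuclideanSpace ℝ (Fin d))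
    (y : Fin K → ℝ) (β : EuclideanSpace ℝ (Fin d)) : ℝ :=
  surplus Λ (utility x β) - y ⬝ᵥ utility x β

/-- The score: the gradient of the Fenchel-Young loss in the parameter. -/
def fyScore {K d : ℕ} (Λ : (Fin K → ℝ) → EReal) (x : Fin K → EuclideanSpace ℝ (Fin d))
    (y : Fin K → ℝ) (β : EuclideanSpace ℝ (Fin d)) : EuclideanSpace ℝ (Fin d) :=
  gradient (fyLoss Λ x y) β

/-- The Hessian matrix of the Fenchel-Young loss in the parameter. -/
def fyHessian {K d : ℕ} (Λ : (Fin K → ℝ) → EReal) (x : Fin K → EuclideanSpace ℝ (Fin d))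
    (y : Fin K → ℝ) (β : EuclideanSpace ℝ (Fin d)) : Matrix (Fin d) (Fin d) ℝ :=
  Matrix.of fun i j => iteratedFDeriv ℝ 2 (fyLoss Λ x y) β
    ![EuclideanSpace.single i 1, EuclideanSpace.single j 1]

/-- The empirical Fenchel-Young risk of the first `N` observations. -/
def empiricalRisk {K d : ℕ} (Λ : (Fin K → ℝ) → EReal)
    (x : ℕ → Fin K → EuclideanSpace ℝ (Fin d)) (y : ℕ → Fin K → ℝ) (N : ℕ)
    (β : EuclideanSpace ℝ (Fin d)) : ℝ :=
  (N : ℝ)⁻¹ * ∑ n ∈ Finset.range N, fyLoss Λ (x n) (y n) β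

/-- The expected Hessian `H(β) = E[∇² ℓ(β; X, Y)]`. -/
def expectedHessian {K d : ℕ} {S : Type*} [MeasurableSpace S] (μ : Measure S)
    (Λ : (Fin K → ℝ) → EReal) (X : S → Fin K → EuclideanSpace ℝ (Fin d)) (Y : S → Fin K → ℝ)
    (β : EuclideanSpace ℝ (Fin d)) : Matrix (Fin d) (Fin d) ℝ :=
  Matrix.of fun i j => ∫ ω, fyHessian Λ (X ω) (Y ω) β i j ∂μ

/-- The second moment matrix of the score, `J(β) = E[g(β) g(β)ᵀ]`. -/
def scoreCovariance {K d : ℕ} {S : Type*} [MeasurableSpace S] (μ : Measure S)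
    (Λ : (Fin K → ℝ) → EReal) (X : S → Fin K → EuclideanSpace ℝ (Fin d)) (Y : S → Fin K → ℝ)
    (β : EuclideanSpace ℝ (Fin d)) : Matrix (Fin d) (Fin d) ℝ :=
  Matrix.of fun i j => ∫ ω, fyScore Λ (X ω) (Y ω) β i * fyScore Λ (X ω) (Y ω) β j ∂μ

end FenchelYoung

end

/-! The argument is the convex M-estimation route, which needs neither a separate consistency proof
nor compactness of `B`. Since the maximizer over the simplex is unique, it depends continuously on
the utilities and is the gradient of the surplus (`hasFDerivAt_surplus`). Hence the loss is convex
in the parameter with gradient `∑ (p_i - y_i) x_i`. At `βstar` this score is centred by correct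
specification and square integrable, so the central limit theorem applies to it. Let `G_N` be the
mean score. Almost surely `G_N(βstar + h) = G_N(βstar) + H h + o(‖h‖)` uniformly over large `N`
(`ae_uniform_expansion`): the supremum over a small ball of the relative Taylor error of one
observation has small mean by dominated convergence, and the strong law carries this to the sample.
Only differentiability of the score at the single point `βstar` and the Lipschitz envelope enter. As
`H` is coercive and `G_N(βstar) → 0`, the gradient eventually points outwards on a small sphere
around `βstar`. Convexity then forces minimizers to exist and to lie inside
(`eventually_norm_apply_sub_add_gradient_le`), where `G_N` vanishes. Inverting `H` shows that the
estimation error is `-H⁻¹ G_N(βstar)` up to a vanishing relative error, and Slutsky's lemma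
concludes. -/

namespace FenchelYoung

/-! ### Choice probabilities, the surplus and the gradient of the loss. -/

variable {K : ℕ} {Λ : (Fin K → ℝ) → EReal}

/-- The choice probability vector of an admissible perturbation. -/
noncomputable def choiceProb (hΛ : IsPerturbation Λ) (V : Fin K → ℝ) : Fin K → ℝ :=
  (hΛ.existsUnique_choiceProb V).choose

theorem isChoiceProb_choiceProb (hΛ : IsPerturbation Λ) (V : Fin K → ℝ) :
    IsChoiceProb Λ V (choiceProb hΛ V) :=
  (hΛ.existsUnique_choiceProb V).choose_spec.1

theorem IsChoiceProb.eq_choiceProb (hΛ : IsPerturbation Λ) {V p : Fin K → ℝ}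
    (h : IsChoiceProb Λ V p) : p = choiceProb hΛ V :=
  (hΛ.existsUnique_choiceProb V).choose_spec.2 p h

theorem choiceProb_mem (hΛ : IsPerturbation Λ) (V : Fin K → ℝ) :
    choiceProb hΛ V ∈ stdSimplex ℝ (Fin K) :=
  (isChoiceProb_choiceProb hΛ V).1

/-- Otherwise the optimal value would be `⊥`, yet a relative interior point of the simplex already
has a finite value. -/
theorem perturbation_choiceProb_ne_top (hΛ : IsPerturbation Λ) (V : Fin K → ℝ) :
    Λ (choiceProb hΛ V) ≠ ⊤ := by
  obtain ⟨q, hq⟩ := Set.Nonempty.intrinsicInterior (convex_stdSimplex ℝ (Fin K))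
    ⟨_, choiceProb_mem hΛ 0⟩
  intro htop
  have hqs := intrinsicInterior_subset hq
  have h := (isChoiceProb_choiceProb hΛ V).2 q hqs
  rw [htop, EReal.sub_top, le_bot_iff] at h
  lift Λ q to ℝ using ⟨hΛ.ne_top q hq, hΛ.ne_bot q hqs⟩ with t
  rw [← EReal.coe_sub] at h
  exact EReal.coe_ne_bot _ h

/-- The surplus is attained at the choice probability vector. -/
theorem perturbation_choiceProb (hΛ : IsPerturbation Λ) (V : Fin K → ℝ) :
    Λ (choiceProb hΛ V) = ((choiceProb hΛ V ⬝ᵥ V - surplus Λ V : ℝ) : EReal) := by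
  have hsup : (⨆ p ∈ stdSimplex ℝ (Fin K), ((p ⬝ᵥ V : ℝ) : EReal) - Λ p) =
      ((choiceProb hΛ V ⬝ᵥ V : ℝ) : EReal) - Λ (choiceProb hΛ V) :=
    le_antisymm (iSup₂_le (isChoiceProb_choiceProb hΛ V).2)
      (le_iSup₂ (f := fun p (_ : p ∈ stdSimplex ℝ (Fin K)) => ((p ⬝ᵥ V : ℝ) : EReal) - Λ p)
        _ (choiceProb_mem hΛ V))
  rw [surplus, hsup]
  lift Λ (choiceProb hΛ V) to ℝ using ⟨perturbation_choiceProb_ne_top hΛ V,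
    hΛ.ne_bot _ (choiceProb_mem hΛ V)⟩ with t
  rw [← EReal.coe_sub, EReal.toReal_coe]
  simp

/-- Converse of `perturbation_choiceProb`; an inequality suffices, and that is what lower
semicontinuity yields in a limit. -/
theorem isChoiceProb_of_le (hΛ : IsPerturbation Λ) {V p : Fin K → ℝ}
    (hp : p ∈ stdSimplex ℝ (Fin K)) (h : Λ p ≤ ((p ⬝ᵥ V - surplus Λ V : ℝ) : EReal)) :
    IsChoiceProb Λ V p := by
  refine ⟨hp, fun q hq => ((isChoiceProb_choiceProb hΛ V).2 q hq).trans ?_⟩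
  rw [perturbation_choiceProb hΛ V]
  lift Λ p to ℝ using ⟨ne_top_of_le_ne_top (EReal.coe_ne_top _) h, hΛ.ne_bot p hp⟩ with t
  rw [← EReal.coe_sub, ← EReal.coe_sub, EReal.coe_le_coe_iff]
  rw [EReal.coe_le_coe_iff] at h
  linarith

/-- The choice probability vector is a subgradient of the surplus. -/
theorem surplus_add_dotProduct_le (hΛ : IsPerturbation Λ) (V W : Fin K → ℝ) :
    surplus Λ V + choiceProb hΛ V ⬝ᵥ (W - V) ≤ surplus Λ W := by
  have h := (isChoiceProb_choiceProb hΛ W).2 _ (choiceProb_mem hΛ V)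
  rw [perturbation_choiceProb hΛ V, perturbation_choiceProb hΛ W, ← EReal.coe_sub,
    ← EReal.coe_sub, EReal.coe_le_coe_iff] at h
  rw [dotProduct_sub]
  linarith

theorem abs_dotProduct_le_of_mem_stdSimplex {p : Fin K → ℝ} (hp : p ∈ stdSimplex ℝ (Fin K))
    (V : Fin K → ℝ) : |p ⬝ᵥ V| ≤ ‖V‖ := by
  calc |p ⬝ᵥ V| ≤ ∑ i, |p i * V i| := Finset.abs_sum_le_sum_abs _ _
    _ ≤ ∑ i, p i * ‖V‖ := Finset.sum_le_sum fun i _ => by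
      rw [abs_mul, abs_of_nonneg (hp.1 i)]
      exact mul_le_mul_of_nonneg_left (norm_le_pi_norm V i) (hp.1 i)
    _ = ‖V‖ := by rw [← Finset.sum_mul, hp.2, one_mul]

/-- Subgradients in the simplex have `ℓ¹` norm one, so the surplus is 1-Lipschitz for the sup norm.
-/
theorem continuous_surplus (hΛ : IsPerturbation Λ) : Continuous (surplus Λ) := by
  refine (LipschitzWith.of_le_add fun V W => ?_).continuous
  have h := surplus_add_dotProduct_le hΛ V W
  have h' := (abs_le.1 (abs_dotProduct_le_of_mem_stdSimplex (choiceProb_mem hΛ V) (W - V))).1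
  rw [dist_comm, dist_eq_norm]
  linarith

theorem convexOn_surplus (hΛ : IsPerturbation Λ) : ConvexOn ℝ Set.univ (surplus Λ) := by
  refine ⟨convex_univ, fun V _ W _ a b ha hb hab => ?_⟩
  have hV := mul_le_mul_of_nonneg_left (surplus_add_dotProduct_le hΛ (a • V + b • W) V) ha
  have hW := mul_le_mul_of_nonneg_left (surplus_add_dotProduct_le hΛ (a • V + b • W) W) hb
  simp only [dotProduct_sub, dotProduct_add, dotProduct_smul, smul_eq_mul] at hV hW ⊢
  obtain rfl : b = 1 - a := by linarith
  nlinarith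

/-- Berge's maximum theorem: by compactness it is enough that every cluster point of `choiceProb hΛ
W` as `W → V` is optimal at `V`, and uniqueness identifies it. -/
theorem continuous_choiceProb (hΛ : IsPerturbation Λ) : Continuous (choiceProb hΛ) := by
  refine continuous_iff_continuousAt.2 fun V => ?_
  refine (isCompact_stdSimplex ℝ (Fin K)).tendsto_nhds_of_unique_mapClusterPt
    (Eventually.of_forall fun W => choiceProb_mem hΛ W) fun q hq hclus => ?_
  refine (isChoiceProb_of_le hΛ hq (le_of_not_gt fun hlt => ?_)).eq_choiceProb hΛ
  -- If `q` is not optimal, `t` separates: near `q` one has `Λ > t`, but `Λ (choiceProb hΛ W)`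
  -- equals `p · W - Ω(W)`, which is below `t` for `(p, W)` near `(q, V)`.
  obtain ⟨t, ht₁, ht₂⟩ := EReal.lt_iff_exists_real_btwn.1 hlt
  have hlsc : ∀ᶠ q' in 𝓝 q, q' ∈ stdSimplex ℝ (Fin K) → (t : EReal) < Λ q' :=
    eventually_nhdsWithin_iff.1 (hΛ.lowerSemicontinuousOn q hq t ht₂)
  have hcont : ∀ᶠ z in 𝓝 q ×ˢ 𝓝 V, z.1 ⬝ᵥ z.2 - surplus Λ z.2 < t := by
    have hc : Continuous fun z : (Fin K → ℝ) × (Fin K → ℝ) => z.1 ⬝ᵥ z.2 - surplus Λ z.2 :=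
      (continuous_fst.dotProduct continuous_snd).sub ((continuous_surplus hΛ).comp continuous_snd)
    rw [← nhds_prod_eq]
    exact hc.continuousAt.eventually (gt_mem_nhds (EReal.coe_lt_coe_iff.1 ht₁))
  obtain ⟨P, hP, Q, hQ, hPQ⟩ := eventually_prod_iff.1 hcont
  obtain ⟨W, hW, hWQ⟩ := ((hclus.frequently (hlsc.and hP)).and_eventually hQ).exists
  have h₁ := hW.1 (choiceProb_mem hΛ W)
  rw [perturbation_choiceProb hΛ W, EReal.coe_lt_coe_iff] at h₁
  exact lt_asymm h₁ (hPQ hW.2 hWQ)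

theorem abs_dotProduct_le (v w : Fin K → ℝ) : |v ⬝ᵥ w| ≤ K * ‖v‖ * ‖w‖ := by
  calc |v ⬝ᵥ w| ≤ ∑ i, |v i * w i| := Finset.abs_sum_le_sum_abs _ _
    _ ≤ ∑ _i : Fin K, ‖v‖ * ‖w‖ := Finset.sum_le_sum fun i _ => by
      rw [abs_mul]
      exact mul_le_mul (norm_le_pi_norm v i) (norm_le_pi_norm w i) (abs_nonneg _) (norm_nonneg _)
    _ = K * ‖v‖ * ‖w‖ := by simp [mul_assoc]

/-- The surplus is differentiable, and its derivative is given by the choice probabilities. -/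
theorem hasFDerivAt_surplus (hΛ : IsPerturbation Λ) (V : Fin K → ℝ) :
    HasFDerivAt (surplus Λ)
      (∑ i, choiceProb hΛ V i • (ContinuousLinearMap.proj i : (Fin K → ℝ) →L[ℝ] ℝ)) V := by
  rw [hasFDerivAt_iff_isLittleO, Asymptotics.isLittleO_iff]
  intro c hc
  have hlim : Tendsto (fun W => K * ‖choiceProb hΛ W - choiceProb hΛ V‖) (𝓝 V) (𝓝 0) := by
    have hc := (continuous_choiceProb hΛ).tendsto V
    simpa using ((hc.sub_const (choiceProb hΛ V)).norm).const_mul (K : ℝ)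
  filter_upwards [hlim.eventually (gt_mem_nhds hc)] with W hW
  have hdot : (∑ i, choiceProb hΛ V i • (ContinuousLinearMap.proj i : (Fin K → ℝ) →L[ℝ] ℝ))
      (W - V) = choiceProb hΛ V ⬝ᵥ (W - V) := by
    simp [dotProduct]
  rw [hdot, Real.norm_eq_abs]
  -- The subgradient inequalities at `V` and `W` squeeze the Taylor remainder between `0` and `(p(W)
  -- - p(V)) · (W - V)`.
  have h₁ := surplus_add_dotProduct_le hΛ V W
  have h₂ := surplus_add_dotProduct_le hΛ W V
  have h₃ := (le_abs_self _).trans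
    (abs_dotProduct_le (choiceProb hΛ W - choiceProb hΛ V) (W - V))
  have h₄ := mul_le_mul_of_nonneg_right hW.le (norm_nonneg (W - V))
  rw [← neg_sub W V, dotProduct_neg] at h₂
  rw [sub_dotProduct] at h₃
  rw [abs_of_nonneg (by linarith)]
  linarith

variable {d : ℕ}

theorem continuous_utility :
    Continuous fun z : (Fin K → EuclideanSpace ℝ (Fin d)) × EuclideanSpace ℝ (Fin d) =>
      utility z.1 z.2 := by
  unfold utility
  fun_prop

/-- The part of the score that does not depend on the observed choice, `∑ i, p_i(V(x; β)) x_i`. -/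
noncomputable def expectedAttribute (hΛ : IsPerturbation Λ) (x : Fin K → EuclideanSpace ℝ (Fin d))
    (β : EuclideanSpace ℝ (Fin d)) : EuclideanSpace ℝ (Fin d) :=
  ∑ i, choiceProb hΛ (utility x β) i • x i

theorem continuous_expectedAttribute (hΛ : IsPerturbation Λ) :
    Continuous (Function.uncurry (expectedAttribute (d := d) hΛ)) := by
  have h (i : Fin K) := (continuous_apply i).comp
    ((continuous_choiceProb hΛ).comp (continuous_utility (d := d)))
  exact continuous_finsetSum Finset.univ fun i _ =>
    (h i).smul ((continuous_apply i).comp continuous_fst)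

/-- The observed choice enters only through a term constant in `β`, so increments and derivatives of
the score are those of `expectedAttribute`. -/
theorem hasGradientAt_fyLoss (hΛ : IsPerturbation Λ) (x : Fin K → EuclideanSpace ℝ (Fin d))
    (y : Fin K → ℝ) (β : EuclideanSpace ℝ (Fin d)) :
    HasGradientAt (fyLoss Λ x y) (expectedAttribute hΛ x β - ∑ i, y i • x i) β := by
  have hu : HasFDerivAt (utility x)
      (ContinuousLinearMap.pi fun i => (innerSL ℝ (x i) : EuclideanSpace ℝ (Fin d) →L[ℝ] ℝ)) β := by
    rw [hasFDerivAt_pi]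
    intro i
    have h := (innerSL ℝ (x i)).hasFDerivAt (x := β)
    simpa [utility, real_inner_comm] using h
  have hy : HasFDerivAt (fun β => y ⬝ᵥ utility x β)
      (∑ i, y i • (innerSL ℝ (x i) : EuclideanSpace ℝ (Fin d) →L[ℝ] ℝ)) β := by
    refine HasFDerivAt.fun_sum fun i _ => ?_
    exact (hasFDerivAt_pi.1 hu i).const_mul (y i)
  rw [hasGradientAt_iff_hasFDerivAt]
  convert! ((hasFDerivAt_surplus hΛ (utility x β)).comp β hu).sub hy using 1
  ext v
  simp [expectedAttribute]

theorem fyScore_eq (hΛ : IsPerturbation Λ) (x : Fin K → EuclideanSpace ℝ (Fin d))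
    (y : Fin K → ℝ) (β : EuclideanSpace ℝ (Fin d)) :
    fyScore Λ x y β = expectedAttribute hΛ x β - ∑ i, y i • x i :=
  (hasGradientAt_fyLoss hΛ x y β).gradient

theorem convexOn_fyLoss (hΛ : IsPerturbation Λ) (x : Fin K → EuclideanSpace ℝ (Fin d))
    (y : Fin K → ℝ) : ConvexOn ℝ Set.univ (fyLoss Λ x y) := by
  refine ⟨convex_univ, fun β _ γ _ a b ha hb hab => ?_⟩
  have hu : utility x (a • β + b • γ) = a • utility x β + b • utility x γ := by
    ext i
    simp [utility, inner_add_left, inner_smul_left]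
  have h := (convexOn_surplus hΛ).2 (Set.mem_univ (utility x β)) (Set.mem_univ (utility x γ))
    ha hb hab
  simp only [fyLoss, hu, dotProduct_add, dotProduct_smul, smul_eq_mul] at h ⊢
  linarith

end FenchelYoung

/-! ### Localization of minimizers of convex functions. -/

section ConvexMinimization

variable {E : Type*} [NormedAddCommGroup E] [InnerProductSpace ℝ E] [ProperSpace E]
  [CompleteSpace E]

/-- If the gradient of a convex function points outwards on a sphere around `b` inside `B`, then a
minimizer over `B` exists, and all minimizers are critical points inside the sphere. -/
theorem ConvexOn.norm_sub_le_and_gradient_eq_zero {f : E → ℝ} {g : E → E}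
    (hf : ConvexOn ℝ Set.univ f) (hg : ∀ x, HasGradientAt f (g x) x) {b β : E} {B : Set E} {δ : ℝ}
    (hδ : 0 < δ) (hB : Metric.closedBall b δ ⊆ B)
    (hout : ∀ c, ‖c - b‖ = δ → 0 < inner ℝ (g c) (c - b))
    (hβ : (∃ c ∈ B, IsMinOn f B c) → β ∈ B ∧ IsMinOn f B β) :
    ‖β - b‖ ≤ δ ∧ g β = 0 := by
  have hcrit : ∀ z, IsMinOn f Set.univ z → g z = 0 := fun z hz => by
    have h := (hz.isLocalMin univ_mem).hasFDerivAt_eq_zero (hg z).hasFDerivAt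
    simpa using h
  have hcont : Continuous f := continuous_iff_continuousAt.2 fun x => (hg x).continuousAt
  obtain ⟨c, hc, hcmin⟩ := (isCompact_closedBall b δ).exists_isMinOn
    ⟨b, Metric.mem_closedBall_self hδ.le⟩ hcont.continuousOn
  -- A minimizer on the sphere would have nonnegative derivative towards `b`, against `hout`.
  have hcδ : ‖c - b‖ < δ := by
    rw [Metric.mem_closedBall, dist_eq_norm] at hc
    refine lt_of_le_of_ne hc fun h => ?_
    have hseg : segment ℝ c b ⊆ Metric.closedBall b δ :=
      (convex_closedBall b δ).segment_subset (by rwa [Metric.mem_closedBall, dist_eq_norm])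
        (Metric.mem_closedBall_self hδ.le)
    have h' := hcmin.localize.hasFDerivWithinAt_nonneg (hg c).hasFDerivAt.hasFDerivWithinAt
      (sub_mem_posTangentConeAt_of_segment_subset hseg)
    rw [InnerProductSpace.toDual_apply_apply, ← neg_sub c b, inner_neg_right] at h'
    linarith [hout c h]
  have hcuniv : IsMinOn f Set.univ c := by
    have hloc : IsLocalMin f c := hcmin.isLocalMin
      (Metric.closedBall_mem_nhds_of_mem (by rwa [Metric.mem_ball, dist_eq_norm]))
    exact fun x _ => IsMinOn.of_isLocalMin_of_convex_univ hloc hf x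
  obtain ⟨-, hβmin⟩ := hβ ⟨c, hB hc, fun x _ => hcuniv (Set.mem_univ x)⟩
  have hβc : f β ≤ f c := hβmin (hB hc)
  have hβuniv : IsMinOn f Set.univ β := fun x hx => hβc.trans (hcuniv hx)
  refine ⟨le_of_not_gt fun hlt => ?_, hcrit β hβuniv⟩
  -- The segment from `c` to a minimizer outside the ball crosses the sphere. By convexity the
  -- crossing point is a global minimizer, hence critical, against `hout`.
  have hpath : ContinuousOn (fun t : ℝ => ‖c + t • (β - c) - b‖) (Set.Icc 0 1) := by fun_prop
  obtain ⟨t, ht, hts⟩ := intermediate_value_Icc zero_le_one hpath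
    (show δ ∈ _ from ⟨by simpa using hcδ.le, by simpa using hlt.le⟩)
  have hz : IsMinOn f Set.univ (c + t • (β - c)) := fun x hx => by
    have h := hf.2 (Set.mem_univ c) (Set.mem_univ β) (sub_nonneg.2 ht.2) ht.1
      (sub_add_cancel 1 t)
    have heq : (1 - t) • c + t • β = c + t • (β - c) := by module
    rw [heq, smul_eq_mul, smul_eq_mul] at h
    have hcx : f c ≤ f x := hcuniv hx
    have h' := mul_le_mul_of_nonneg_left hβc ht.1
    change f _ ≤ f x
    linarith
  have h := hout _ hts
  rw [hcrit _ hz, inner_zero_left] at h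
  exact lt_irrefl _ h

/-- Linearization of the first-order condition of minimizers of convex functions whose gradients
admit a uniform first-order expansion at `b`. -/
theorem eventually_norm_apply_sub_add_gradient_le {f : ℕ → E → ℝ} {g : ℕ → E → E}
    (hf : ∀ N, ConvexOn ℝ Set.univ (f N)) (hg : ∀ N x, HasGradientAt (f N) (g N x) x)
    {A : E →L[ℝ] E} {m : ℝ} (hm : 0 < m) (hA : ∀ h, m * ‖h‖ ^ 2 ≤ inner ℝ (A h) h)
    {b : E} {B : Set E} (hB : b ∈ interior B)
    (hexp : ∀ ε > 0, ∃ δ > 0, ∀ᶠ N in atTop, ∀ h, ‖h‖ ≤ δ →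
      ‖g N (b + h) - g N b - A h‖ ≤ ε * ‖h‖)
    (hzero : Tendsto (fun N => g N b) atTop (𝓝 0)) {β : ℕ → E}
    (hβ : ∀ N, (∃ c ∈ B, IsMinOn (f N) B c) → β N ∈ B ∧ IsMinOn (f N) B (β N))
    {ε : ℝ} (hε : 0 < ε) :
    ∀ᶠ N in atTop, ‖A (β N - b) + g N b‖ ≤ ε * ‖β N - b‖ := by
  -- On the sphere of radius `δ`, coercivity contributes `m δ²`. The expansion error costs at most
  -- `m/2 · δ²` and `g N b` strictly less than the other half, so the gradient points outwards.
  obtain ⟨δ₁, hδ₁, hexp₁⟩ := hexp (min ε (m / 2)) (by positivity)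
  obtain ⟨δ₂, hδ₂, hball⟩ := Metric.nhds_basis_closedBall.mem_iff.1 (mem_interior_iff_mem_nhds.1 hB)
  set δ := min δ₁ δ₂ with hδ_def
  have hδ : 0 < δ := lt_min hδ₁ hδ₂
  have hsmall : ∀ᶠ N in atTop, ‖g N b‖ < m / 2 * δ := by
    have h := hzero.norm
    rw [norm_zero] at h
    exact h.eventually (gt_mem_nhds (by positivity))
  filter_upwards [hexp₁, hsmall] with N hN hs
  obtain ⟨hβδ, hβ0⟩ := (hf N).norm_sub_le_and_gradient_eq_zero (hg N) (β := β N) hδ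
    ((Metric.closedBall_subset_closedBall (min_le_right _ _)).trans hball) (fun c hc => by
      have h₁ := hN (c - b) (by rw [hc]; exact min_le_left _ _)
      rw [add_sub_cancel] at h₁
      have h₂ : -(min ε (m / 2) * δ * δ) ≤ inner ℝ (g N c - g N b - A (c - b)) (c - b) := by
        have h₃ := neg_le_of_abs_le (abs_real_inner_le_norm (g N c - g N b - A (c - b)) (c - b))
        have h₄ := mul_le_mul_of_nonneg_right h₁ (norm_nonneg (c - b))
        rw [hc] at h₃ h₄
        linarith
      have h₃ := neg_le_of_abs_le (abs_real_inner_le_norm (g N b) (c - b))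
      have h₄ := hA (c - b)
      rw [inner_sub_left, inner_sub_left] at h₂
      rw [hc] at h₃ h₄
      have h₅ : min ε (m / 2) * δ * δ ≤ m / 2 * δ * δ := by
        gcongr
        exact min_le_right _ _
      nlinarith) (hβ N)
  have h := hN (β N - b) (hβδ.trans (min_le_left _ _))
  rw [add_sub_cancel, hβ0, zero_sub, ← norm_neg, neg_sub, sub_neg_eq_add] at h
  exact h.trans (mul_le_mul_of_nonneg_right (min_le_left _ _) (norm_nonneg _))

end ConvexMinimization

/-! ### Multivariate central limit theorem. -/

section MultivariateCLT

/-- The multivariate central limit theorem for centred vectors. -/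
theorem tendstoInDistribution_inv_sqrt_smul_sum_multivariateGaussian {ι S : Type*} [Fintype ι]
    [DecidableEq ι] [MeasurableSpace S] {μ : Measure S} [IsProbabilityMeasure μ]
    {Z : ℕ → S → EuclideanSpace ℝ ι} {Q : Matrix ι ι ℝ} (hQ : Q.PosSemidef)
    (hZ : MemLp (Z 0) 2 μ) (hmean : ∫ ω, Z 0 ω ∂μ = 0)
    (hcov : ∀ t, ∫ ω, inner ℝ t (Z 0 ω) ^ 2 ∂μ = t.ofLp ⬝ᵥ Q *ᵥ t.ofLp)
    (hindep : iIndepFun Z μ) (hident : ∀ n, IdentDistrib (Z n) (Z 0) μ μ) :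
    TendstoInDistribution (fun (N : ℕ) ω => (√(N : ℝ))⁻¹ • ∑ n ∈ Finset.range N, Z n ω) atTop id
      (fun _ => μ) (multivariateGaussian 0 Q) := by
  have hmeas (N : ℕ) : AEMeasurable (fun ω => (√(N : ℝ))⁻¹ • ∑ n ∈ Finset.range N, Z n ω) μ := by
    have h (n : ℕ) : AEMeasurable (Z n) μ := (hident n).aemeasurable_fst
    fun_prop
  refine ⟨hmeas, aemeasurable_id, ?_⟩
  -- Cramér–Wold: the characteristic function at `t` is that of the scalar projection on `t`
  -- evaluated at `1`.
  refine ProbabilityMeasure.tendsto_iff_tendsto_charFun.2 fun t => ?_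
  have ht : Measurable fun z : EuclideanSpace ℝ ι => inner ℝ t z := by fun_prop
  have hL : MemLp (fun ω => inner ℝ t (Z 0 ω)) 2 μ := hZ.const_inner t
  have hm : ∫ ω, inner ℝ t (Z 0 ω) ∂μ = 0 := by
    rw [integral_inner (hZ.integrable one_le_two), hmean, inner_zero_right]
  have hv : Var[fun ω => inner ℝ t (Z 0 ω); μ] = t.ofLp ⬝ᵥ Q *ᵥ t.ofLp := by
    rw [variance_eq_integral hL.aemeasurable, hm, ← hcov t]
    simp
  have hclt := tendstoInDistribution_inv_sqrt_mul_sum_sub (P := μ)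
    (X := fun n ω => inner ℝ t (Z n ω))
    (P' := gaussianReal 0 (Var[fun ω => inner ℝ t (Z 0 ω); μ]).toNNReal) (Y := id)
    HasLaw.id hL (hindep.comp (fun _ z => inner ℝ t z) fun _ => ht)
    fun n => (hident n).comp ht
  have hlim := ProbabilityMeasure.tendsto_iff_tendsto_charFun.1 hclt.tendsto 1
  have hQt : 0 ≤ t.ofLp ⬝ᵥ Q *ᵥ t.ofLp := by
    simpa using hQ.dotProduct_mulVec_nonneg t.ofLp
  simp only [ProbabilityMeasure.coe_mk, Measure.map_id, charFun_gaussianReal,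
    charFun_multivariateGaussian hQ] at hlim ⊢
  convert! hlim using 2
  · rename_i N
    rw [charFun_apply, charFun_apply, integral_map (hmeas N) (by fun_prop),
      integral_map (hclt.forall_aemeasurable N) (by fun_prop)]
    congr 1
    ext ω
    congr 3
    rw [hm]
    simp [inner_smul_left, sum_inner, real_inner_comm]
  · simp [hv, hQt]

end MultivariateCLT

/-! ### Uniform first-order expansion of empirical means. -/

section UniformExpansion

variable {E : Type*} [NormedAddCommGroup E] [NormedSpace ℝ E]

/-- The relative error of the first-order expansion of `F` at `b` with derivative `D` at the
increment `h`, cut off outside of the ball of radius `δ`. -/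
noncomputable def expansionError (F : E → E) (D : E →L[ℝ] E) (b : E) (δ : ℝ) (h : E) : ℝ :=
  if ‖h‖ < δ then ‖F (b + h) - F b - D h‖ / ‖h‖ else 0

variable {F : E → E} {D : E →L[ℝ] E} {b : E} {δ c : ℝ}

theorem expansionError_nonneg (h : E) : 0 ≤ expansionError F D b δ h := by
  unfold expansionError
  split_ifs <;> positivity

theorem expansionError_le (hc : 0 ≤ c)
    (hF : ∀ h, ‖h‖ < δ → ‖F (b + h) - F b - D h‖ ≤ c * ‖h‖) (h : E) :
    expansionError F D b δ h ≤ c := by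
  unfold expansionError
  split_ifs with hh
  · exact div_le_of_le_mul₀ (norm_nonneg _) hc (hF h hh)
  · exact hc

/-- A derivative with an integrable Lipschitz envelope is integrable. -/
theorem integrable_of_hasFDerivAt_of_lipschitz {S : Type*} [MeasurableSpace S]
    {μ : Measure S} {F : S → E → E} {D : S → E →L[ℝ] E} {b : E}
    (hD : AEStronglyMeasurable D μ) (hFD : ∀ᵐ ω ∂μ, HasFDerivAt (F ω) (D ω) b)
    {m : S → ℝ} (hm : Integrable m μ) {U : Set E} (hU : U ∈ 𝓝 b)
    (hlip : ∀ᵐ ω ∂μ, ∀ β ∈ U, ‖F ω β - F ω b‖ ≤ m ω * ‖β - b‖) :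
    (∀ᵐ ω ∂μ, ‖D ω‖ ≤ |m ω|) ∧ Integrable D μ := by
  have h : ∀ᵐ ω ∂μ, ‖D ω‖ ≤ |m ω| := by
    filter_upwards [hFD, hlip] with ω h₁ h₂
    refine h₁.le_of_lip' (abs_nonneg _) ?_
    filter_upwards [hU] with β hβ
    exact (h₂ β hβ).trans (mul_le_mul_of_nonneg_right (le_abs_self _) (norm_nonneg _))
  exact ⟨h, hm.abs.mono' hD h⟩

variable [TopologicalSpace.SeparableSpace E]

/-- The supremum of the relative error of the first-order expansion over the ball of radius `δ`,
computed along a dense sequence. -/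
noncomputable def expansionModulus (F : E → E) (D : E →L[ℝ] E) (b : E) (δ : ℝ) : ℝ :=
  ⨆ j, expansionError F D b δ (TopologicalSpace.denseSeq E j)

theorem expansionModulus_nonneg : 0 ≤ expansionModulus F D b δ :=
  Real.iSup_nonneg fun _ => expansionError_nonneg _

theorem expansionModulus_le (hc : 0 ≤ c)
    (hF : ∀ h, ‖h‖ < δ → ‖F (b + h) - F b - D h‖ ≤ c * ‖h‖) :
    expansionModulus F D b δ ≤ c :=
  ciSup_le fun _ => expansionError_le hc hF _

/-- The bound `c` ensures that the supremum is a genuine one: a real `iSup` of an unbounded family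
is `0`. -/
theorem expansionError_le_expansionModulus (hc : 0 ≤ c)
    (hF : ∀ h, ‖h‖ < δ → ‖F (b + h) - F b - D h‖ ≤ c * ‖h‖) (j : ℕ) :
    expansionError F D b δ (TopologicalSpace.denseSeq E j) ≤ expansionModulus F D b δ :=
  le_ciSup (f := fun j => expansionError F D b δ (TopologicalSpace.denseSeq E j))
    ⟨c, Set.forall_mem_range.2 fun _ => expansionError_le hc hF _⟩ j

/-- Continuity extends the bound from the dense sequence to the open ball. The hypothesis `hle` is a
countable family of inequalities, so that it can be transferred between identically distributed
observations. -/
theorem norm_sub_le_expansionModulus (hF : Continuous F)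
    (hle : ∀ j, expansionError F D b δ (TopologicalSpace.denseSeq E j) ≤ expansionModulus F D b δ)
    {h : E} (hh : ‖h‖ < δ) :
    ‖F (b + h) - F b - D h‖ ≤ expansionModulus F D b δ * ‖h‖ := by
  have hclosed : IsClosed {h : E | ‖F (b + h) - F b - D h‖ ≤ expansionModulus F D b δ * ‖h‖} :=
    isClosed_le (by fun_prop) (by fun_prop)
  have hmem := (TopologicalSpace.denseRange_denseSeq E).open_subset_closure_inter
    (Metric.isOpen_ball (x := (0 : E)) (ε := δ)) (by simpa using hh : h ∈ Metric.ball 0 δ)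
  refine hclosed.closure_subset_iff.2 ?_ hmem
  rintro _ ⟨hj, j, rfl⟩
  have hj' : ‖TopologicalSpace.denseSeq E j‖ < δ := by simpa using hj
  have h := hle j
  rw [expansionError, if_pos hj'] at h
  rcases (norm_nonneg (TopologicalSpace.denseSeq E j)).eq_or_lt with h0 | h0
  · have h0' := norm_eq_zero.1 h0.symm
    simp [h0']
  · exact (div_le_iff₀ h0).1 h

theorem measurable_expansionError {𝒳 : Type*} [MeasurableSpace 𝒳] [FiniteDimensional ℝ E]
    [MeasurableSpace E] [BorelSpace E] {F : 𝒳 → E → E} {D : 𝒳 → E →L[ℝ] E}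
    (hF : ∀ β, Measurable fun x => F x β) (hD : Measurable D) (b : E) (δ : ℝ) (h : E) :
    Measurable fun x => expansionError (F x) (D x) b δ h := by
  unfold expansionError
  split_ifs
  · exact ((((hF _).sub (hF _)).sub (hD.apply_continuousLinearMap h)).norm).div_const _
  · exact measurable_const

theorem measurable_expansionModulus {𝒳 : Type*} [MeasurableSpace 𝒳] [FiniteDimensional ℝ E]
    [MeasurableSpace E] [BorelSpace E] {F : 𝒳 → E → E} {D : 𝒳 → E →L[ℝ] E}
    (hF : ∀ β, Measurable fun x => F x β) (hD : Measurable D) (b : E) (δ : ℝ) :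
    Measurable fun x => expansionModulus (F x) (D x) b δ :=
  Measurable.iSup fun _ => measurable_expansionError hF hD b δ _

theorem tendsto_expansionModulus (hFD : HasFDerivAt F D b) {δ : ℕ → ℝ}
    (hδ : Tendsto δ atTop (𝓝 0)) :
    Tendsto (fun k => expansionModulus F D b (δ k)) atTop (𝓝 0) := by
  rw [Metric.tendsto_nhds]
  intro c hc
  have h := (hasFDerivAt_iff_isLittleO_nhds_zero.1 hFD).def (half_pos hc)
  obtain ⟨r, hr, hball⟩ := Metric.eventually_nhds_iff.1 h
  filter_upwards [hδ.eventually (gt_mem_nhds hr)] with k hk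
  rw [Real.dist_0_eq_abs, abs_of_nonneg expansionModulus_nonneg]
  refine (expansionModulus_le (half_pos hc).le fun h hh => ?_).trans_lt (half_lt_self hc)
  exact hball (by rw [dist_zero_right]; exact hh.trans hk)

variable {S 𝒳 : Type*} [MeasurableSpace S] {μ : Measure S} [MeasurableSpace 𝒳]
  [FiniteDimensional ℝ E] [MeasurableSpace E] [BorelSpace E]

/-- Empirical means of i.i.d. random functions admit, almost surely, a uniform first-order
expansion at a point of differentiability, given an integrable Lipschitz envelope there. -/
theorem ae_uniform_expansion {ξ : ℕ → S → 𝒳} (hξ : Measurable (ξ 0))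
    (hindep : Pairwise (Function.onFun (fun f g => IndepFun f g μ) ξ))
    (hident : ∀ n, IdentDistrib (ξ n) (ξ 0) μ μ)
    {F : 𝒳 → E → E} {D : 𝒳 → E →L[ℝ] E} {b : E}
    (hF : ∀ β, Measurable fun x => F x β) (hFc : ∀ x, Continuous (F x)) (hD : Measurable D)
    (hFD : ∀ᵐ ω ∂μ, HasFDerivAt (F (ξ 0 ω)) (D (ξ 0 ω)) b)
    {m : S → ℝ} (hm : Integrable m μ) {U : Set E} (hU : U ∈ 𝓝 b)
    (hlip : ∀ᵐ ω ∂μ, ∀ β ∈ U, ‖F (ξ 0 ω) β - F (ξ 0 ω) b‖ ≤ m ω * ‖β - b‖) :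
    ∀ᵐ ω ∂μ, ∀ ε > 0, ∃ δ > 0, ∀ᶠ N : ℕ in atTop, ∀ h, ‖h‖ ≤ δ →
      ‖(N : ℝ)⁻¹ • ∑ n ∈ Finset.range N, (F (ξ n ω) (b + h) - F (ξ n ω) b)
        - (∫ ω, D (ξ 0 ω) ∂μ) h‖ ≤ ε * ‖h‖ := by
  obtain ⟨hDm, hDint⟩ := integrable_of_hasFDerivAt_of_lipschitz (F := fun ω => F (ξ 0 ω))
    (D := fun ω => D (ξ 0 ω)) (hD.comp hξ).aestronglyMeasurable hFD hm hU hlip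
  obtain ⟨δ₀, hδ₀, hball⟩ := Metric.nhds_basis_ball.mem_iff.1 hU
  set δ : ℕ → ℝ := fun k => δ₀ / ((k : ℝ) + 1) with hδ_def
  have hδpos (k : ℕ) : 0 < δ k := by positivity
  have hδle (k : ℕ) : δ k ≤ δ₀ := div_le_self hδ₀.le (by linarith [Nat.cast_nonneg (α := ℝ) k])
  have hδlim : Tendsto δ atTop (𝓝 0) :=
    tendsto_const_nhds.div_atTop (tendsto_atTop_add_const_right _ _ tendsto_natCast_atTop_atTop)
  set ρ : ℕ → 𝒳 → ℝ := fun k x => expansionModulus (F x) (D x) b (δ k) with hρ_def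
  have hρmeas (k : ℕ) : Measurable (ρ k) := measurable_expansionModulus hF hD b (δ k)
  -- One `|m ω|` bounds the increment of `F`, the other the derivative.
  have hbound : ∀ᵐ ω ∂μ, ∀ k h, ‖h‖ < δ k →
      ‖F (ξ 0 ω) (b + h) - F (ξ 0 ω) b - D (ξ 0 ω) h‖ ≤ (2 * |m ω|) * ‖h‖ := by
    filter_upwards [hDm, hlip] with ω h₁ h₂ k h hh
    have h₃ := h₂ (b + h) (hball (by simpa using hh.trans_le (hδle k)))
    rw [add_sub_cancel_left] at h₃
    calc _ ≤ ‖F (ξ 0 ω) (b + h) - F (ξ 0 ω) b‖ + ‖D (ξ 0 ω) h‖ := norm_sub_le _ _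
      _ ≤ |m ω| * ‖h‖ + |m ω| * ‖h‖ := add_le_add
        (h₃.trans (mul_le_mul_of_nonneg_right (le_abs_self _) (norm_nonneg _)))
        ((D (ξ 0 ω)).le_of_opNorm_le h₁ h)
      _ = _ := by ring
  have hρle (k : ℕ) : ∀ᵐ ω ∂μ, ‖ρ k (ξ 0 ω)‖ ≤ 2 * |m ω| := by
    filter_upwards [hbound] with ω h
    rw [Real.norm_eq_abs, abs_of_nonneg expansionModulus_nonneg]
    exact expansionModulus_le (by positivity) (h k)
  have hρint (k : ℕ) : Integrable (fun ω => ρ k (ξ 0 ω)) μ :=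
    (hm.abs.const_mul 2).mono' ((hρmeas k).comp hξ).aestronglyMeasurable (hρle k)
  have hρlim : Tendsto (fun k => ∫ ω, ρ k (ξ 0 ω) ∂μ) atTop (𝓝 0) := by
    have h := tendsto_integral_of_dominated_convergence (μ := μ) (f := fun _ => (0 : ℝ))
      (F := fun k ω => ρ k (ξ 0 ω)) (fun ω => 2 * |m ω|)
      (fun k => ((hρmeas k).comp hξ).aestronglyMeasurable) (hm.abs.const_mul 2) hρle
      (hFD.mono fun ω hω => tendsto_expansionModulus hω hδlim)
    simpa using h
  -- The envelope is given for the observation `ξ 0` only. The dense-sequence inequalities form a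
  -- measurable condition on `x`, so they pass to every `ξ n` by equality of laws.
  have hdense : ∀ᵐ ω ∂μ, ∀ n k j, expansionError (F (ξ n ω)) (D (ξ n ω)) b (δ k)
      (TopologicalSpace.denseSeq E j) ≤ ρ k (ξ n ω) := by
    refine ae_all_iff.2 fun n => ?_
    refine (hident n).symm.ae_snd (p := fun x => ∀ k j, expansionError (F x) (D x) b (δ k)
      (TopologicalSpace.denseSeq E j) ≤ ρ k x) ?_ ?_
    · simp only [Set.ofPred_forall]
      exact MeasurableSet.iInter fun k => MeasurableSet.iInter fun j =>
        measurableSet_le (measurable_expansionError hF hD b (δ k) _) (hρmeas k)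
    · filter_upwards [hbound] with ω h k j
      exact expansionError_le_expansionModulus (by positivity) (h k) j
  have hslln : ∀ᵐ ω ∂μ, ∀ k, Tendsto (fun N : ℕ => (N : ℝ)⁻¹ • ∑ n ∈ Finset.range N, ρ k (ξ n ω))
      atTop (𝓝 (∫ ω, ρ k (ξ 0 ω) ∂μ)) :=
    ae_all_iff.2 fun k => strong_law_ae (fun n ω => ρ k (ξ n ω)) (hρint k)
      (fun i j hij => (hindep hij).comp (hρmeas k) (hρmeas k)) fun n => (hident n).comp (hρmeas k)
  have hsllnD : ∀ᵐ ω ∂μ, Tendsto (fun N : ℕ => (N : ℝ)⁻¹ • ∑ n ∈ Finset.range N, D (ξ n ω))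
      atTop (𝓝 (∫ ω, D (ξ 0 ω) ∂μ)) :=
    strong_law_ae (fun n ω => D (ξ n ω)) hDint
      (fun i j hij => (hindep hij).comp hD hD) fun n => (hident n).comp hD
  filter_upwards [hdense, hslln, hsllnD] with ω hω₁ hω₂ hω₃ ε hε
  -- The radius is fixed through the expected modulus before `N` grows. Half of `ε` goes to the mean
  -- modulus, half to the deviation of the mean derivative; `δ k / 2` puts the closed ball inside
  -- the open one.
  obtain ⟨k, hk⟩ := (hρlim.eventually (gt_mem_nhds (half_pos hε))).exists
  refine ⟨δ k / 2, half_pos (hδpos k), ?_⟩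
  filter_upwards [(hω₂ k).eventually (gt_mem_nhds hk),
    hω₃.eventually (Metric.ball_mem_nhds _ (half_pos hε))] with N hN₁ hN₂ h hh
  rw [dist_eq_norm] at hN₂
  have hh' : ‖h‖ < δ k := hh.trans_lt (half_lt_self (hδpos k))
  have hrem : ‖(N : ℝ)⁻¹ • ∑ n ∈ Finset.range N,
      (F (ξ n ω) (b + h) - F (ξ n ω) b - D (ξ n ω) h)‖ ≤ ε / 2 * ‖h‖ := by
    rw [norm_smul, norm_inv, RCLike.norm_natCast]
    calc _ ≤ (N : ℝ)⁻¹ * ∑ n ∈ Finset.range N, ρ k (ξ n ω) * ‖h‖ := by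
          gcongr
          exact norm_sum_le_of_le _ fun n _ =>
            norm_sub_le_expansionModulus (hFc _) (hω₁ n k) hh'
      _ = ((N : ℝ)⁻¹ • ∑ n ∈ Finset.range N, ρ k (ξ n ω)) * ‖h‖ := by
          rw [← Finset.sum_mul, smul_eq_mul, mul_assoc]
      _ ≤ ε / 2 * ‖h‖ := mul_le_mul_of_nonneg_right hN₁.le (norm_nonneg _)
  have hlin := ((N : ℝ)⁻¹ • ∑ n ∈ Finset.range N, D (ξ n ω)
    - ∫ ω, D (ξ 0 ω) ∂μ).le_of_opNorm_le hN₂.le h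
  have heq : (N : ℝ)⁻¹ • ∑ n ∈ Finset.range N, (F (ξ n ω) (b + h) - F (ξ n ω) b)
        - (∫ ω, D (ξ 0 ω) ∂μ) h =
      (N : ℝ)⁻¹ • ∑ n ∈ Finset.range N, (F (ξ n ω) (b + h) - F (ξ n ω) b - D (ξ n ω) h)
        + ((N : ℝ)⁻¹ • ∑ n ∈ Finset.range N, D (ξ n ω) - ∫ ω, D (ξ 0 ω) ∂μ) h := by
    simp only [Finset.sum_sub_distrib, _root_.sub_apply, _root_.smul_apply,
      _root_.sum_apply, smul_sub]
    abel
  rw [heq]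
  calc _ ≤ _ := norm_add_le _ _
    _ ≤ ε / 2 * ‖h‖ + ε / 2 * ‖h‖ := add_le_add hrem hlin
    _ = ε * ‖h‖ := by ring

end UniformExpansion

section ContinuousExpansion

variable {𝒳 E : Type*} [TopologicalSpace 𝒳] [MeasurableSpace 𝒳]
  [BorelSpace 𝒳] [NormedAddCommGroup E] [NormedSpace ℝ E] [FiniteDimensional ℝ E]
  [MeasurableSpace E] [BorelSpace E] {F : 𝒳 → E → E}

/-- The derivative at a point of a jointly continuous function depends measurably on the
parameter. -/
theorem measurable_fderiv_of_continuous_uncurry (hF : Continuous (Function.uncurry F)) (b : E) :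
    Measurable fun x => fderiv ℝ (F x) b := by
  have := FiniteDimensional.proper_real E
  have := FiniteDimensional.complete ℝ E
  have : SecondCountableTopology E := secondCountable_of_proper
  exact (measurable_fderiv_with_param ℝ hF).comp measurable_prodMk_right

/-- Empirical means of jointly continuous functions of an i.i.d. sample admit, almost surely, a
uniform first-order expansion at a point of differentiability, given an integrable Lipschitz
envelope there. -/
theorem integrable_fderiv_and_ae_uniform_expansion {S : Type*} [MeasurableSpace S] {μ : Measure S}
    {ξ : ℕ → S → 𝒳} (hξ : Measurable (ξ 0))
    (hindep : Pairwise (Function.onFun (fun f g => IndepFun f g μ) ξ))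
    (hident : ∀ n, IdentDistrib (ξ n) (ξ 0) μ μ) (hF : Continuous (Function.uncurry F)) {b : E}
    (hFD : ∀ᵐ ω ∂μ, DifferentiableAt ℝ (F (ξ 0 ω)) b)
    {m : S → ℝ} (hm : Integrable m μ) {U : Set E} (hU : U ∈ 𝓝 b)
    (hlip : ∀ᵐ ω ∂μ, ∀ β ∈ U, ‖F (ξ 0 ω) β - F (ξ 0 ω) b‖ ≤ m ω * ‖β - b‖) :
    Integrable (fun ω => fderiv ℝ (F (ξ 0 ω)) b) μ ∧
    ∀ᵐ ω ∂μ, ∀ ε > 0, ∃ δ > 0, ∀ᶠ N : ℕ in atTop, ∀ h, ‖h‖ ≤ δ →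
      ‖(N : ℝ)⁻¹ • ∑ n ∈ Finset.range N, (F (ξ n ω) (b + h) - F (ξ n ω) b)
        - (∫ ω, fderiv ℝ (F (ξ 0 ω)) b ∂μ) h‖ ≤ ε * ‖h‖ := by
  have := FiniteDimensional.proper_real E
  have : SecondCountableTopology E := secondCountable_of_proper
  obtain ⟨D, hDF⟩ : ∃ D : 𝒳 → E →L[ℝ] E, D = fun x => fderiv ℝ (F x) b := ⟨_, rfl⟩
  have hD : Measurable D := hDF ▸ measurable_fderiv_of_continuous_uncurry hF b
  have hFD' : ∀ᵐ ω ∂μ, HasFDerivAt (F (ξ 0 ω)) (D (ξ 0 ω)) b :=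
    hFD.mono fun ω h => hDF ▸ h.hasFDerivAt
  have hDξ (ω : S) : fderiv ℝ (F (ξ 0 ω)) b = D (ξ 0 ω) := by rw [hDF]
  simp only [hDξ]
  have hmeas : AEStronglyMeasurable (fun ω => D (ξ 0 ω)) μ := (hD.comp hξ).aestronglyMeasurable
  exact ⟨(integrable_of_hasFDerivAt_of_lipschitz (F := fun ω => F (ξ 0 ω)) hmeas
      hFD' hm hU hlip).2,
    ae_uniform_expansion hξ hindep hident
      (fun β => (hF.comp (continuous_id.prodMk continuous_const)).measurable)
      (fun x => hF.comp (continuous_const.prodMk continuous_id)) hD hFD' hm hU hlip⟩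

end ContinuousExpansion

/-! ### Slutsky's lemma with relative errors. -/

section Slutsky

/-- A sequence whose relative distance to a sequence converging in distribution vanishes almost
surely converges in distribution to the same limit. -/
theorem TendstoInDistribution.of_ae_norm_sub_le {E S S' : Type*} [NormedAddCommGroup E]
    [NormedSpace ℝ E] [MeasurableSpace E] [BorelSpace E] [SecondCountableTopology E]
    [MeasurableSpace S] {μ : Measure S} [IsProbabilityMeasure μ]
    [MeasurableSpace S'] {μ' : Measure S'} [IsProbabilityMeasure μ'] {T R : ℕ → S → E} {Z : S' → E}
    (hT : TendstoInDistribution T atTop Z (fun _ => μ) μ') (hR : ∀ N, AEMeasurable (R N) μ)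
    (hclose : ∀ᵐ ω ∂μ, ∀ η > 0, ∀ᶠ N in atTop, ‖R N ω - T N ω‖ ≤ η * ‖T N ω‖) :
    TendstoInDistribution R atTop Z (fun _ => μ) μ' := by
  have hTm := hT.forall_aemeasurable
  set c : ℕ → S → E := fun N ω => ‖T N ω‖⁻¹ • (R N ω - T N ω) with hc_def
  have hcm (N : ℕ) : AEMeasurable (c N) μ := (hTm N).norm.inv.smul ((hR N).sub (hTm N))
  have hc0 : ∀ᵐ ω ∂μ, Tendsto (fun N => c N ω) atTop (𝓝 0) := by
    filter_upwards [hclose] with ω hω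
    rw [NormedAddGroup.tendsto_nhds_zero]
    intro ε hε
    filter_upwards [hω (ε / 2) (half_pos hε)] with N hN
    rw [norm_smul, norm_inv, norm_norm]
    refine lt_of_le_of_lt ?_ (half_lt_self hε)
    rw [inv_mul_eq_div]
    exact div_le_of_le_mul₀ (norm_nonneg _) (half_pos hε).le hN
  -- The pair `(T, c)` converges jointly to `(Z, 0)`, and the continuous map `p.1 + ‖p.1‖ • p.2`
  -- rebuilds `R` from it.
  have hmain := hT.continuous_comp_prodMk_of_tendstoInMeasure_const
    (g := fun p : E × E => p.1 + ‖p.1‖ • p.2) (by fun_prop)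
    (tendstoInMeasure_of_tendsto_ae (fun N => (hcm N).aestronglyMeasurable) hc0) hcm
  simp only [smul_zero, add_zero] at hmain
  refine tendstoInDistribution_of_tendstoInMeasure_sub R Z hmain ?_ hR
  refine tendstoInMeasure_of_tendsto_ae
    (fun N => ((hR N).sub (hmain.forall_aemeasurable N)).aestronglyMeasurable) ?_
  filter_upwards [hclose] with ω hω
  refine tendsto_const_nhds.congr' ?_
  -- Where `T N ω = 0`, the inverse norm in `c` is `0`, but the bound with `η = 1` forces `R N ω =
  -- 0`, so the rebuilding is exact there too.
  filter_upwards [hω 1 one_pos] with N hN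
  rcases eq_or_ne (T N ω) 0 with h0 | h0
  · rw [h0, norm_zero, mul_zero, sub_zero, norm_le_zero_iff] at hN
    simp [h0, hN]
  · simp [hc_def, smul_smul, mul_inv_cancel₀ (norm_ne_zero_iff.2 h0)]

end Slutsky

section Coercive

/-- A positive definite operator on a finite-dimensional space is coercive. -/
theorem exists_pos_mul_sq_norm_le_inner {E : Type*} [NormedAddCommGroup E] [InnerProductSpace ℝ E]
    [FiniteDimensional ℝ E] {A : E →L[ℝ] E} (hA : ∀ h ≠ 0, 0 < inner ℝ (A h) h) :
    ∃ m > 0, ∀ h, m * ‖h‖ ^ 2 ≤ inner ℝ (A h) h := by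
  rcases subsingleton_or_nontrivial E with hE | hE
  · exact ⟨1, one_pos, fun h => by simp [Subsingleton.elim h 0]⟩
  have := FiniteDimensional.proper_real E
  -- The constant is the minimum of the quadratic form on the unit sphere; homogeneity does the
  -- rest.
  obtain ⟨u, hu, hmin⟩ := (isCompact_sphere (0 : E) 1).exists_isMinOn
    (NormedSpace.sphere_nonempty.2 zero_le_one)
    (show ContinuousOn (fun h => inner ℝ (A h) h) _ by fun_prop)
  have hu1 : ‖u‖ = 1 := by simpa using hu
  refine ⟨inner ℝ (A u) u, hA u (by rintro rfl; simp at hu1), fun h => ?_⟩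
  rcases eq_or_ne h 0 with rfl | h0
  · simp
  have hn := norm_ne_zero_iff.2 h0
  have h1 : inner ℝ (A u) u ≤ inner ℝ (A (‖h‖⁻¹ • h)) (‖h‖⁻¹ • h) :=
    hmin (by simp [norm_smul, hn])
  rw [map_smul, real_inner_smul_left, real_inner_smul_right] at h1
  calc _ ≤ ‖h‖⁻¹ * (‖h‖⁻¹ * inner ℝ (A h) h) * ‖h‖ ^ 2 := by gcongr
    _ = _ := by field_simp

end Coercive

/-! ### Second derivative of the loss. -/

namespace FenchelYoung

variable {K d : ℕ} {Λ : (Fin K → ℝ) → EReal}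

theorem contDiffAt_fyLoss {x : Fin K → EuclideanSpace ℝ (Fin d)} (y : Fin K → ℝ)
    {β : EuclideanSpace ℝ (Fin d)} (h : ContDiffAt ℝ 2 (surplus Λ) (utility x β)) :
    ContDiffAt ℝ 2 (fyLoss Λ x y) β := by
  have hu : ContDiff ℝ 2 (utility x) :=
    contDiff_pi.2 fun i => contDiff_id.inner ℝ contDiff_const
  have hy : ContDiff ℝ 2 fun β => y ⬝ᵥ utility x β :=
    ContDiff.sum fun i _ => contDiff_const.mul (contDiff_pi.1 hu i)
  exact (h.comp β hu.contDiffAt).sub hy.contDiffAt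

theorem fderiv_fyLoss (hΛ : IsPerturbation Λ) (x : Fin K → EuclideanSpace ℝ (Fin d))
    (y : Fin K → ℝ) :
    fderiv ℝ (fyLoss Λ x y) = fun β => innerSL ℝ (expectedAttribute hΛ x β - ∑ i, y i • x i) := by
  ext β v
  rw [(hasGradientAt_fyLoss hΛ x y β).hasFDerivAt.fderiv]
  rfl

/-- For `y = 0` this map is the Riesz representative of the derivative of a loss that is twice
continuously differentiable at `β`. -/
theorem differentiableAt_expectedAttribute (hΛ : IsPerturbation Λ)
    {x : Fin K → EuclideanSpace ℝ (Fin d)} {β : EuclideanSpace ℝ (Fin d)}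
    (h : ContDiffAt ℝ 2 (surplus Λ) (utility x β)) :
    DifferentiableAt ℝ (expectedAttribute hΛ x) β := by
  have h₁ : DifferentiableAt ℝ (fderiv ℝ (fyLoss Λ x 0)) β :=
    ((contDiffAt_fyLoss 0 h).fderiv_right (m := 1) (by norm_num)).differentiableAt one_ne_zero
  have h₂ : expectedAttribute hΛ x = fun γ =>
      (InnerProductSpace.toDual ℝ (EuclideanSpace ℝ (Fin d))).symm (fderiv ℝ (fyLoss Λ x 0) γ) := by
    ext1 γ
    rw [(hasGradientAt_fyLoss hΛ x 0 γ).hasFDerivAt.fderiv]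
    simp
  rw [h₂]
  exact (InnerProductSpace.toDual ℝ
    (EuclideanSpace ℝ (Fin d))).symm.differentiableAt.comp β h₁

theorem fyHessian_eq (hΛ : IsPerturbation Λ) {x : Fin K → EuclideanSpace ℝ (Fin d)}
    (y : Fin K → ℝ) {β : EuclideanSpace ℝ (Fin d)}
    (h : DifferentiableAt ℝ (expectedAttribute hΛ x) β) (i j : Fin d) :
    fyHessian Λ x y β i j =
      fderiv ℝ (expectedAttribute hΛ x) β (EuclideanSpace.single i 1) j := by
  have h' : HasFDerivAt
      (fun γ => innerSL ℝ (expectedAttribute hΛ x γ - ∑ i, y i • x i)) _ β :=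
    (innerSL ℝ : EuclideanSpace ℝ (Fin d) →L[ℝ] _).hasFDerivAt.comp β
    (h.hasFDerivAt.sub_const (∑ i, y i • x i))
  rw [fyHessian, Matrix.of_apply, iteratedFDeriv_two_apply, fderiv_fyLoss hΛ,
    HasFDerivAt.fderiv h']
  simp [innerSL_apply_apply ℝ, EuclideanSpace.inner_single_right]

end FenchelYoung

/-! ### Moments of the score and convexity of the empirical risk. -/

namespace FenchelYoung

variable {K d : ℕ} {Λ : (Fin K → ℝ) → EReal} {S : Type*} [MeasurableSpace S] {μ : Measure S}

theorem abs_choiceProb_le_one (hΛ : IsPerturbation Λ) (V : Fin K → ℝ) (i : Fin K) :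
    |choiceProb hΛ V i| ≤ 1 := by
  have h := mem_Icc_of_mem_stdSimplex (choiceProb_mem hΛ V) i
  rw [abs_of_nonneg h.1]
  exact h.2

theorem abs_le_one_of_onehot {y : Fin K → ℝ} (hy : ∃ i, y = Pi.single i 1) (i : Fin K) :
    |y i| ≤ 1 := by
  obtain ⟨j, rfl⟩ := hy
  rcases eq_or_ne i j with rfl | h
  · simp
  · simp [h]

theorem measurable_choiceProb_utility (hΛ : IsPerturbation Λ) (β : EuclideanSpace ℝ (Fin d))
    (i : Fin K) : Measurable fun x : Fin K → EuclideanSpace ℝ (Fin d) =>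
      choiceProb hΛ (utility x β) i :=
  ((continuous_apply i).comp ((continuous_choiceProb hΛ).comp
    (continuous_utility.comp (continuous_id.prodMk continuous_const)))).measurable

theorem measurable_expectedAttribute (hΛ : IsPerturbation Λ) (β : EuclideanSpace ℝ (Fin d)) :
    Measurable fun x => expectedAttribute hΛ x β :=
  ((continuous_expectedAttribute hΛ).comp (continuous_id.prodMk continuous_const)).measurable

theorem measurable_fyScore (hΛ : IsPerturbation Λ) (β : EuclideanSpace ℝ (Fin d)) :
    Measurable fun z : (Fin K → EuclideanSpace ℝ (Fin d)) × (Fin K → ℝ) =>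
      fyScore Λ z.1 z.2 β := by
  simp only [fyScore_eq hΛ]
  exact ((measurable_expectedAttribute hΛ β).comp measurable_fst).sub (by fun_prop)

theorem memLp_smul_of_abs_le_one {E : Type*} [NormedAddCommGroup E] [NormedSpace ℝ E] {c : S → ℝ}
    {Z : S → E} (hc : AEStronglyMeasurable c μ) (hc1 : ∀ᵐ ω ∂μ, |c ω| ≤ 1) (hZ : MemLp Z 2 μ) :
    MemLp (fun ω => c ω • Z ω) 2 μ := by
  refine hZ.of_le (hc.smul hZ.aestronglyMeasurable) ?_
  filter_upwards [hc1] with ω h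
  rw [norm_smul, Real.norm_eq_abs]
  exact mul_le_of_le_one_left (norm_nonneg _) h

theorem memLp_attribute {X : S → Fin K → EuclideanSpace ℝ (Fin d)} (hX : Measurable X)
    (hmom : MemLp X 2 μ) (i : Fin K) : MemLp (fun ω => X ω i) 2 μ :=
  hmom.of_le ((measurable_pi_apply i).comp hX).aestronglyMeasurable
    (ae_of_all _ fun ω => norm_le_pi_norm (X ω) i)

theorem memLp_choiceProb_smul (hΛ : IsPerturbation Λ)
    {X : S → Fin K → EuclideanSpace ℝ (Fin d)} (hX : Measurable X) (hmom : MemLp X 2 μ)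
    (β : EuclideanSpace ℝ (Fin d)) (i : Fin K) :
    MemLp (fun ω => choiceProb hΛ (utility (X ω) β) i • X ω i) 2 μ :=
  memLp_smul_of_abs_le_one
    ((measurable_choiceProb_utility hΛ β i).comp hX).aestronglyMeasurable
    (ae_of_all _ fun _ => abs_choiceProb_le_one hΛ _ i) (memLp_attribute hX hmom i)

theorem memLp_choice_smul {X : S → Fin K → EuclideanSpace ℝ (Fin d)} (hX : Measurable X)
    (hmom : MemLp X 2 μ) {Y : S → Fin K → ℝ} (hY : Measurable Y)
    (honehot : ∀ᵐ ω ∂μ, ∃ i, Y ω = Pi.single i 1) (i : Fin K) :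
    MemLp (fun ω => Y ω i • X ω i) 2 μ :=
  memLp_smul_of_abs_le_one ((measurable_pi_apply i).comp hY).aestronglyMeasurable
    (honehot.mono fun _ h => abs_le_one_of_onehot h i) (memLp_attribute hX hmom i)

/-- The score has finite second moment. -/
theorem memLp_fyScore (hΛ : IsPerturbation Λ) {X : S → Fin K → EuclideanSpace ℝ (Fin d)}
    (hX : Measurable X) (hmom : MemLp X 2 μ) {Y : S → Fin K → ℝ} (hY : Measurable Y)
    (honehot : ∀ᵐ ω ∂μ, ∃ i, Y ω = Pi.single i 1) (β : EuclideanSpace ℝ (Fin d)) :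
    MemLp (fun ω => fyScore Λ (X ω) (Y ω) β) 2 μ := by
  simp only [fyScore_eq hΛ]
  exact (memLp_finsetSum Finset.univ fun i _ => memLp_choiceProb_smul hΛ hX hmom β i).sub
    (memLp_finsetSum Finset.univ fun i _ => memLp_choice_smul hX hmom hY honehot i)

/-- Under correct specification the score is centred. -/
theorem integral_fyScore_eq_zero [IsProbabilityMeasure μ] (hΛ : IsPerturbation Λ)
    {X : S → Fin K → EuclideanSpace ℝ (Fin d)} (hX : Measurable X) (hmom : MemLp X 2 μ)
    {Y : S → Fin K → ℝ} (hY : Measurable Y)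
    (honehot : ∀ᵐ ω ∂μ, ∃ i, Y ω = Pi.single i 1) {β : EuclideanSpace ℝ (Fin d)}
    (hspec : ∀ᵐ ω ∂μ, IsChoiceProb Λ (utility (X ω) β)
      ((μ[Y | MeasurableSpace.comap X inferInstance]) ω)) :
    ∫ ω, fyScore Λ (X ω) (Y ω) β ∂μ = 0 := by
  have hm : MeasurableSpace.comap X inferInstance ≤ ‹MeasurableSpace S› := hX.comap_le
  have hpX (i : Fin K) : Integrable (fun ω => choiceProb hΛ (utility (X ω) β) i • X ω i) μ :=
    (memLp_choiceProb_smul hΛ hX hmom β i).integrable one_le_two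
  have hYX (i : Fin K) : Integrable (fun ω => Y ω i • X ω i) μ :=
    (memLp_choice_smul hX hmom hY honehot i).integrable one_le_two
  have hYi (i : Fin K) : Integrable (fun ω => Y ω i) μ :=
    (integrable_const (1 : ℝ)).mono' ((measurable_pi_apply i).comp hY).aestronglyMeasurable
      (honehot.mono fun _ h => abs_le_one_of_onehot h i)
  have hYint : Integrable Y μ := Integrable.of_eval hYi
  have hkey (i : Fin K) : ∫ ω, Y ω i • X ω i ∂μ =
      ∫ ω, choiceProb hΛ (utility (X ω) β) i • X ω i ∂μ := by
    have hXi : AEStronglyMeasurable[MeasurableSpace.comap X inferInstance] (fun ω => X ω i) μ :=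
      ((measurable_pi_apply i).comp
        (comap_measurable X)).stronglyMeasurable.aestronglyMeasurable
    rw [← integral_condExp hm]
    refine integral_congr_ae ?_
    -- Conditioning on `X` pulls `X ω i` out, and coordinates commute with conditional expectation,
    -- so correct specification replaces `Y` by the choice probability.
    filter_upwards [condExp_smul_of_aestronglyMeasurable_right (hYi i) (hYX i) hXi,
      (ContinuousLinearMap.proj (R := ℝ) (φ := fun _ : Fin K => ℝ) i).comp_condExp_comm
        (m := MeasurableSpace.comap X inferInstance) hYint, hspec] with ω h₁ h₂ h₃
    rw [← h₃.eq_choiceProb hΛ]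
    refine h₁.trans ?_
    rw [Pi.smul_apply']
    congr 1
    exact h₂.symm
  simp only [fyScore_eq hΛ, expectedAttribute]
  rw [integral_sub (integrable_finsetSum _ fun i _ => hpX i)
    (integrable_finsetSum _ fun i _ => hYX i), integral_finsetSum _ fun i _ => hpX i,
    integral_finsetSum _ fun i _ => hYX i, sub_eq_zero]
  exact Finset.sum_congr rfl fun i _ => (hkey i).symm

/-- The quadratic form of the second moment matrix of the score. -/
theorem integral_inner_fyScore_sq {X : S → Fin K → EuclideanSpace ℝ (Fin d)}
    {Y : S → Fin K → ℝ} {β : EuclideanSpace ℝ (Fin d)}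
    (hL2 : MemLp (fun ω => fyScore Λ (X ω) (Y ω) β) 2 μ) (u : EuclideanSpace ℝ (Fin d)) :
    ∫ ω, inner ℝ u (fyScore Λ (X ω) (Y ω) β) ^ 2 ∂μ =
      u.ofLp ⬝ᵥ scoreCovariance μ Λ X Y β *ᵥ u.ofLp := by
  have hi (i : Fin d) : MemLp (fun ω => fyScore Λ (X ω) (Y ω) β i) 2 μ :=
    hL2.of_le (by
      have := hL2.aestronglyMeasurable.aemeasurable
      exact (AEMeasurable.aestronglyMeasurable (by fun_prop)))
      (ae_of_all _ fun ω => PiLp.norm_apply_le _ i)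
  have hij (i j : Fin d) : Integrable
      (fun ω => u i * (fyScore Λ (X ω) (Y ω) β i * fyScore Λ (X ω) (Y ω) β j * u j)) μ :=
    (((hi i).integrable_mul (hi j)).mul_const (u j)).const_mul (u i)
  have hexpand (ω : S) : inner ℝ u (fyScore Λ (X ω) (Y ω) β) ^ 2 =
      ∑ i, ∑ j, u i * (fyScore Λ (X ω) (Y ω) β i * fyScore Λ (X ω) (Y ω) β j * u j) := by
    rw [sq, PiLp.inner_apply, Finset.sum_mul_sum]
    refine Finset.sum_congr rfl fun i _ => Finset.sum_congr rfl fun j _ => ?_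
    simp only [RCLike.inner_apply, conj_trivial]
    ring
  simp only [hexpand]
  rw [integral_finsetSum _ fun i _ => integrable_finsetSum _ fun j _ => hij i j]
  simp only [dotProduct, mulVec, Finset.mul_sum, scoreCovariance, Matrix.of_apply]
  refine Finset.sum_congr rfl fun i _ => ?_
  rw [integral_finsetSum _ fun j _ => hij i j]
  refine Finset.sum_congr rfl fun j _ => ?_
  rw [integral_const_mul, integral_mul_const]

theorem posSemidef_scoreCovariance {X : S → Fin K → EuclideanSpace ℝ (Fin d)}
    {Y : S → Fin K → ℝ} {β : EuclideanSpace ℝ (Fin d)}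
    (hL2 : MemLp (fun ω => fyScore Λ (X ω) (Y ω) β) 2 μ) :
    (scoreCovariance μ Λ X Y β).PosSemidef := by
  refine Matrix.PosSemidef.of_dotProduct_mulVec_nonneg ?_ fun u => ?_
  · ext i j
    simp [scoreCovariance, mul_comm]
  · have h := integral_inner_fyScore_sq hL2 (WithLp.toLp 2 u)
    rw [star_trivial, ← h]
    exact integral_nonneg fun ω => sq_nonneg _

/-- The empirical risk has the mean score as its gradient. -/
theorem hasGradientAt_empiricalRisk (hΛ : IsPerturbation Λ)
    (x : ℕ → Fin K → EuclideanSpace ℝ (Fin d)) (y : ℕ → Fin K → ℝ) (N : ℕ)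
    (β : EuclideanSpace ℝ (Fin d)) :
    HasGradientAt (empiricalRisk Λ x y N)
      ((N : ℝ)⁻¹ • ∑ n ∈ Finset.range N, fyScore Λ (x n) (y n) β) β := by
  have h (n : ℕ) := (hasGradientAt_fyLoss hΛ (x n) (y n) β).hasFDerivAt
  rw [hasGradientAt_iff_hasFDerivAt]
  convert! (HasFDerivAt.fun_sum (u := Finset.range N) fun n _ => h n).const_mul (N : ℝ)⁻¹ using 1
  simp [fyScore_eq hΛ]

theorem convexOn_empiricalRisk (hΛ : IsPerturbation Λ)
    (x : ℕ → Fin K → EuclideanSpace ℝ (Fin d)) (y : ℕ → Fin K → ℝ) (N : ℕ) :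
    ConvexOn ℝ Set.univ (empiricalRisk Λ x y N) := by
  have h : ConvexOn ℝ Set.univ fun β => ∑ n ∈ Finset.range N, fyLoss Λ (x n) (y n) β := by
    induction N with
    | zero => simpa using convexOn_const (0 : ℝ) convex_univ
    | succ N ih =>
      simp only [Finset.sum_range_succ]
      exact ih.add (convexOn_fyLoss hΛ (x N) (y N))
  exact h.smul (by positivity : 0 ≤ (N : ℝ)⁻¹)

end FenchelYoung

/-! ### Linearization of the estimating equation. -/

namespace FenchelYoung

variable {K d : ℕ} {Λ : (Fin K → ℝ) → EReal} {S : Type*} [MeasurableSpace S] {μ : Measure S}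

/-- The expected derivative of the score is the operator of the expected Hessian. -/
theorem integral_fderiv_expectedAttribute (hΛ : IsPerturbation Λ)
    {X : S → Fin K → EuclideanSpace ℝ (Fin d)} {Y : S → Fin K → ℝ} {β : EuclideanSpace ℝ (Fin d)}
    (hdiff : ∀ᵐ ω ∂μ, DifferentiableAt ℝ (expectedAttribute hΛ (X ω)) β)
    (hint : Integrable (fun ω => fderiv ℝ (expectedAttribute hΛ (X ω)) β) μ)
    (hsymm : (expectedHessian μ Λ X Y β).IsHermitian) :
    ∫ ω, fderiv ℝ (expectedAttribute hΛ (X ω)) β ∂μ =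
      toEuclideanCLM (n := Fin d) (𝕜 := ℝ) (expectedHessian μ Λ X Y β) := by
  have hentry (i j : Fin d) : (∫ ω, fderiv ℝ (expectedAttribute hΛ (X ω)) β ∂μ)
      (EuclideanSpace.single i 1) j = expectedHessian μ Λ X Y β i j := by
    rw [ContinuousLinearMap.integral_apply hint]
    have h := (EuclideanSpace.proj j : EuclideanSpace ℝ (Fin d) →L[ℝ] ℝ).integral_comp_comm
      (hint.apply_continuousLinearMap (EuclideanSpace.single i 1))
    refine h.symm.trans (integral_congr_ae ?_)
    filter_upwards [hdiff] with ω hω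
    exact (fyHessian_eq hΛ (Y ω) hω i j).symm
  refine ContinuousLinearMap.coe_injective
    ((EuclideanSpace.basisFun (Fin d) ℝ).toBasis.ext fun i => ?_)
  ext j
  -- The entry formula produces the transposed matrix; symmetry removes the discrepancy.
  have hji : expectedHessian μ Λ X Y β j i = expectedHessian μ Λ X Y β i j := by
    simpa using hsymm.apply i j
  simp [hentry, hji]

/-- A linearized equation `A r + s ≈ 0` determines `r` up to a small relative error. -/
theorem norm_sub_neg_apply_le {E : Type*} [NormedAddCommGroup E] [NormedSpace ℝ E]
    {A L : E →L[ℝ] E} (hLA : ∀ v, L (A v) = v) {η : ℝ} (hη : 0 < η) {r s : E}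
    (h : ‖A r + s‖ ≤ min 1 η / 2 / (‖L‖ + 1) * ‖r‖) : ‖r - -L s‖ ≤ η * ‖-L s‖ := by
  have hc : 0 < ‖L‖ + 1 := by positivity
  have h₁ : r - -L s = L (A r + s) := by rw [map_add, hLA, sub_neg_eq_add]
  have h₂ : ‖r - -L s‖ ≤ min 1 η / 2 * ‖r‖ := by
    rw [h₁]
    calc _ ≤ (‖L‖ + 1) * (min 1 η / 2 / (‖L‖ + 1) * ‖r‖) :=
          (L.le_opNorm _).trans (mul_le_mul (by linarith) h (norm_nonneg _) hc.le)
      _ = _ := by field_simp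
  -- The `min` with `1` lets half of `‖r‖` be absorbed, giving `‖r‖ ≤ 2 ‖L s‖`; the `η / 2` then
  -- turns into `η`.
  have h₃ : ‖r‖ ≤ ‖r - -L s‖ + ‖-L s‖ := by
    simpa using norm_add_le (r - -L s) (-L s)
  have h₄ : min 1 η / 2 * ‖r‖ ≤ 1 / 2 * ‖r‖ := by
    gcongr
    exact min_le_left _ _
  have h₅ : min 1 η / 2 * ‖r‖ ≤ η / 2 * ‖r‖ := by
    gcongr
    exact min_le_right _ _
  have h₆ : ‖r‖ ≤ 2 * ‖-L s‖ := by linarith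
  have h₇ : η / 2 * ‖r‖ ≤ η / 2 * (2 * ‖-L s‖) := by gcongr
  linarith

/-- The central limit theorem for the image of the score under a symmetric matrix. -/
theorem tendstoInDistribution_linearizedScore [IsProbabilityMeasure μ] (hΛ : IsPerturbation Λ)
    {X : ℕ → S → Fin K → EuclideanSpace ℝ (Fin d)} {Y : ℕ → S → Fin K → ℝ}
    (hindep : iIndepFun (fun n ω => (X n ω, Y n ω)) μ)
    (hident : ∀ n, IdentDistrib (fun ω => (X n ω, Y n ω)) (fun ω => (X 0 ω, Y 0 ω)) μ μ)
    {β : EuclideanSpace ℝ (Fin d)}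
    (hL2 : MemLp (fun ω => fyScore Λ (X 0 ω) (Y 0 ω) β) 2 μ)
    (hmean : ∫ ω, fyScore Λ (X 0 ω) (Y 0 ω) β ∂μ = 0)
    {R : Matrix (Fin d) (Fin d) ℝ} (hR : Rᵀ = R) :
    TendstoInDistribution (fun (N : ℕ) ω => (√(N : ℝ))⁻¹ • ∑ n ∈ Finset.range N,
        -toEuclideanCLM (n := Fin d) (𝕜 := ℝ) R (fyScore Λ (X n ω) (Y n ω) β)) atTop id
      (fun _ => μ) (multivariateGaussian 0 (R * scoreCovariance μ Λ (X 0) (Y 0) β * R)) := by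
  set L := toEuclideanCLM (n := Fin d) (𝕜 := ℝ) R with hL_def
  have hζ : Measurable fun z : (Fin K → EuclideanSpace ℝ (Fin d)) × (Fin K → ℝ) =>
      -L (fyScore Λ z.1 z.2 β) := (L.measurable.comp (measurable_fyScore hΛ β)).neg
  -- Symmetry moves `L` onto the test vector, so the limit has quadratic form `J` at `L t`, that is,
  -- covariance `R J R`.
  have hLsymm (u v : EuclideanSpace ℝ (Fin d)) : inner ℝ u (L v) = inner ℝ (L u) v := by
    rw [hL_def, inner_toEuclideanCLM, real_inner_comm, inner_toEuclideanCLM, dotProduct_mulVec,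
      ← mulVec_transpose, hR, dotProduct_comm]
  refine tendstoInDistribution_inv_sqrt_smul_sum_multivariateGaussian
    (Z := fun n ω => -L (fyScore Λ (X n ω) (Y n ω) β)) ?_ (L.comp_memLp' hL2).neg ?_ (fun t => ?_)
    (hindep.comp (fun _ z => -L (fyScore Λ z.1 z.2 β)) fun _ => hζ) fun n => (hident n).comp hζ
  · simpa [hR, conjTranspose_eq_transpose_of_trivial] using
      (posSemidef_scoreCovariance hL2).conjTranspose_mul_mul_same R
  · rw [integral_neg, L.integral_comp_comm (hL2.integrable one_le_two), hmean, map_zero, neg_zero]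
  · simp only [inner_neg_right, neg_sq, hLsymm]
    rw [integral_inner_fyScore_sq hL2 (L t), hL_def, ofLp_toEuclideanCLM, ← mulVec_mulVec,
      ← mulVec_mulVec, dotProduct_mulVec t.ofLp R, ← mulVec_transpose, hR]

/-- The empirical score admits, almost surely, a uniform first-order expansion whose derivative is
the expected Hessian. -/
theorem ae_uniform_expansion_score (hΛ : IsPerturbation Λ)
    {X : ℕ → S → Fin K → EuclideanSpace ℝ (Fin d)} {Y : ℕ → S → Fin K → ℝ} (hX : Measurable (X 0))
    (hindep : iIndepFun (fun n ω => (X n ω, Y n ω)) μ)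
    (hident : ∀ n, IdentDistrib (fun ω => (X n ω, Y n ω)) (fun ω => (X 0 ω, Y 0 ω)) μ μ)
    {βstar : EuclideanSpace ℝ (Fin d)}
    (hsmooth : ∀ᵐ ω ∂μ, ContDiffAt ℝ 2 (surplus Λ) (utility (X 0 ω) βstar))
    {M : S → ℝ} (hM : Integrable M μ) {U : Set (EuclideanSpace ℝ (Fin d))} (hU : U ∈ 𝓝 βstar)
    (hdom : ∀ᵐ ω ∂μ, ∀ β ∈ U,
      ‖fyScore Λ (X 0 ω) (Y 0 ω) β - fyScore Λ (X 0 ω) (Y 0 ω) βstar‖ ≤ M ω * ‖β - βstar‖)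
    (hsymm : (expectedHessian μ Λ (X 0) (Y 0) βstar).IsHermitian) :
    ∀ᵐ ω ∂μ, ∀ ε > 0, ∃ δ > 0, ∀ᶠ N : ℕ in atTop, ∀ h, ‖h‖ ≤ δ →
      ‖(N : ℝ)⁻¹ • ∑ n ∈ Finset.range N, fyScore Λ (X n ω) (Y n ω) (βstar + h)
        - (N : ℝ)⁻¹ • ∑ n ∈ Finset.range N, fyScore Λ (X n ω) (Y n ω) βstar
        - toEuclideanCLM (n := Fin d) (𝕜 := ℝ) (expectedHessian μ Λ (X 0) (Y 0) βstar) h‖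
        ≤ ε * ‖h‖ := by
  have hindepX : Pairwise (Function.onFun (fun f g => IndepFun f g μ) X) := fun i j hij =>
    (hindep.indepFun hij).comp measurable_fst measurable_fst
  have hdiff : ∀ᵐ ω ∂μ, DifferentiableAt ℝ (expectedAttribute hΛ (X 0 ω)) βstar :=
    hsmooth.mono fun ω h => differentiableAt_expectedAttribute hΛ h
  have hlip : ∀ᵐ ω ∂μ, ∀ β ∈ U,
      ‖expectedAttribute hΛ (X 0 ω) β - expectedAttribute hΛ (X 0 ω) βstar‖ ≤
        M ω * ‖β - βstar‖ := by
    filter_upwards [hdom] with ω h β hβ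
    simpa [fyScore_eq hΛ] using h β hβ
  obtain ⟨hint, hexp⟩ := integrable_fderiv_and_ae_uniform_expansion hX hindepX
    (fun n => (hident n).comp measurable_fst) (continuous_expectedAttribute hΛ) hdiff hM hU hlip
  rw [integral_fderiv_expectedAttribute (Y := Y 0) hΛ hdiff hint hsymm] at hexp
  filter_upwards [hexp] with ω hω ε hε
  obtain ⟨δ, hδ, h⟩ := hω ε hε
  refine ⟨δ, hδ, h.mono fun N hN v hv => ?_⟩
  have h' := hN v hv
  rw [← smul_sub, ← Finset.sum_sub_distrib]
  simp only [fyScore_eq hΛ, sub_sub_sub_cancel_right]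
  exact h'

end FenchelYoung

/-! ### Asymptotic normality. -/

open FenchelYoung in
theorem mainTheorem3 {K d : ℕ} {S : Type*} [MeasurableSpace S]
    (μ : Measure S) [IsProbabilityMeasure μ]
    -- the model
    (Λ : (Fin K → ℝ) → EReal) (hΛ : FenchelYoung.IsPerturbation Λ)
    -- the i.i.d. sample of attributes and one-hot choices
    (X : ℕ → S → Fin K → EuclideanSpace ℝ (Fin d)) (Y : ℕ → S → Fin K → ℝ)
    (hX : ∀ n, Measurable (X n)) (hY : ∀ n, Measurable (Y n))
    (hY_onehot : ∀ n, ∀ᵐ ω ∂μ, ∃ i, Y n ω = Pi.single i 1)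
    (hindep : iIndepFun (fun n ω => (X n ω, Y n ω)) μ)
    (hident : ∀ n, IdentDistrib (fun ω => (X n ω, Y n ω)) (fun ω => (X 0 ω, Y 0 ω)) μ μ)
    -- correct specification at an interior point of the parameter set
    (B : Set (EuclideanSpace ℝ (Fin d))) (βstar : EuclideanSpace ℝ (Fin d))
    (hB : βstar ∈ interior B)
    (hspec : ∀ᵐ ω ∂μ, FenchelYoung.IsChoiceProb Λ (FenchelYoung.utility (X 0 ω) βstar)
      ((μ[Y 0 | MeasurableSpace.comap (X 0) inferInstance]) ω))
    -- the estimator: a minimizer of the empirical risk whenever there is one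
    (βhat : ℕ → S → EuclideanSpace ℝ (Fin d)) (hβhat : ∀ N, AEMeasurable (βhat N) μ)
    (hβhat_min : ∀ N, ∀ᵐ ω ∂μ,
      (∃ b ∈ B, IsMinOn (FenchelYoung.empiricalRisk Λ (fun n => X n ω) (fun n => Y n ω) N) B b) →
        βhat N ω ∈ B ∧
        IsMinOn (FenchelYoung.empiricalRisk Λ (fun n => X n ω) (fun n => Y n ω) N) B (βhat N ω))
    -- regularity of the surplus function, and an integrable envelope for the variation of the score
    (hsmooth : ∀ᵐ ω ∂μ,
      ContDiffAt ℝ 2 (FenchelYoung.surplus Λ) (FenchelYoung.utility (X 0 ω) βstar))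
    (M : (Fin K → EuclideanSpace ℝ (Fin d)) → (Fin K → ℝ) → ℝ)
    (hM : Integrable (fun ω => M (X 0 ω) (Y 0 ω)) μ)
    (U : Set (EuclideanSpace ℝ (Fin d))) (hU : U ∈ 𝓝 βstar)
    (hdom : ∀ᵐ ω ∂μ, ∀ β ∈ U,
      ‖FenchelYoung.fyScore Λ (X 0 ω) (Y 0 ω) β - FenchelYoung.fyScore Λ (X 0 ω) (Y 0 ω) βstar‖ ≤
        M (X 0 ω) (Y 0 ω) * ‖β - βstar‖)
    -- non-singularity
    (hH : (FenchelYoung.expectedHessian μ Λ (X 0) (Y 0) βstar).PosDef)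
    -- finite second moments
    (hmom : MemLp (X 0) 2 μ) :
    TendstoInDistribution (fun (N : ℕ) ω => √(N : ℝ) • (βhat N ω - βstar)) atTop id
      (fun _ => μ)
      (multivariateGaussian 0
        ((FenchelYoung.expectedHessian μ Λ (X 0) (Y 0) βstar)⁻¹ *
          FenchelYoung.scoreCovariance μ Λ (X 0) (Y 0) βstar *
          (FenchelYoung.expectedHessian μ Λ (X 0) (Y 0) βstar)⁻¹)) := by
  have hL2 := memLp_fyScore hΛ (hX 0) hmom (hY 0) (hY_onehot 0) βstar
  have hmean := integral_fyScore_eq_zero hΛ (hX 0) hmom (hY 0) (hY_onehot 0) hspec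
  have hexp := ae_uniform_expansion_score hΛ (hX 0) hindep hident hsmooth hM hU hdom
    hH.isHermitian
  have hscore := measurable_fyScore (d := d) hΛ βstar
  have hslln := strong_law_ae (fun n ω => fyScore Λ (X n ω) (Y n ω) βstar)
    (hL2.integrable one_le_two) (fun i j hij => (hindep.indepFun hij).comp hscore hscore)
    fun n => (hident n).comp hscore
  rw [hmean] at hslln
  have hinv : ((expectedHessian μ Λ (X 0) (Y 0) βstar)⁻¹)ᵀ =
      (expectedHessian μ Λ (X 0) (Y 0) βstar)⁻¹ := by
    simpa [IsHermitian] using hH.isHermitian.inv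
  refine TendstoInDistribution.of_ae_norm_sub_le
    (tendstoInDistribution_linearizedScore hΛ hindep hident hL2 hmean hinv)
    (fun N => ((hβhat N).sub_const βstar).const_smul (√(N : ℝ))) ?_
  generalize expectedHessian μ Λ (X 0) (Y 0) βstar = H at *
  set L := toEuclideanCLM (n := Fin d) (𝕜 := ℝ) H⁻¹ with hL_def
  have hLH (v : EuclideanSpace ℝ (Fin d)) :
      L (toEuclideanCLM (n := Fin d) (𝕜 := ℝ) H v) = v := by
    rw [hL_def, ← mul_apply_eq_comp, ← map_mul, Matrix.nonsing_inv_mul _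
      ((Matrix.isUnit_iff_isUnit_det H).1 hH.isUnit), map_one, one_apply_eq_self]
  obtain ⟨m, hm, hcoer⟩ := exists_pos_mul_sq_norm_le_inner
    (A := toEuclideanCLM (n := Fin d) (𝕜 := ℝ) H) fun h h0 => by
      rw [real_inner_comm, inner_toEuclideanCLM]
      simpa using hH.dotProduct_mulVec_pos (x := h.ofLp) (by simpa using h0)
  filter_upwards [hexp, hslln, ae_all_iff.2 hβhat_min] with ω hω₁ hω₂ hω₃ η hη
  -- From here `ω` is fixed and the argument is deterministic; the tolerance is the one required by
  -- `norm_sub_neg_apply_le`.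
  have hlin := eventually_norm_apply_sub_add_gradient_le
    (convexOn_empiricalRisk hΛ (fun n => X n ω) (fun n => Y n ω))
    (hasGradientAt_empiricalRisk hΛ (fun n => X n ω) (fun n => Y n ω))
    hm hcoer hB hω₁ hω₂ hω₃ (ε := min 1 η / 2 / (‖L‖ + 1)) (by positivity)
  filter_upwards [hlin] with N hN
  -- Since `√N / N = 1 / √N` also at `N = 0`, where both sides are `0`, no case is excluded.
  have hT : (√(N : ℝ))⁻¹ • ∑ n ∈ Finset.range N, -L (fyScore Λ (X n ω) (Y n ω) βstar) =
      √(N : ℝ) • -L ((N : ℝ)⁻¹ • ∑ n ∈ Finset.range N, fyScore Λ (X n ω) (Y n ω) βstar) := by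
    rw [map_smul, map_sum, Finset.sum_neg_distrib, ← smul_neg, smul_smul,
      ← div_eq_mul_inv, Real.sqrt_div_self']
    simp
  rw [hT, ← smul_sub, norm_smul, norm_smul, mul_left_comm]
  exact mul_le_mul_of_nonneg_left (norm_sub_neg_apply_le hLH hη hN) (norm_nonneg _)
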